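/- Let $R$ be a commutative Noetherian ring and $\mathfrak{a}$ a proper ideal of $R$. For an $R$-module $N$ put $\Gamma_{\mathfrak{a}}(N)=\{x\in N \mid \mathfrak{a}^n x=0 \text{ for some } n\ge 0\}$, and apply $\Gamma_{\mathfrak{a}}$ degreewise to complexes (indexed homologically). An $R$-complex $I$ is semiinjective if $\mathrm{Hom}_R(-,I)$ converts injective quasiisomorphisms into surjective quasiisomorphisms; a semiinjective resolution of a complex $M$ is a quasiisomorphism $M\to E$ with $E$ semiinjective, and $\mathbf{R}\Gamma_{\mathfrak{a}}(M)$ is the object $\Gamma_{\mathfrak{a}}(E)$ of the derived category $\mathrm{D}(R)$. An $R$-module $N$ is Gorenstein injective if $N\cong\mathrm{Ker}(E_0\to E_{-1})$ for some acyclic complex $E$ of injective $R$-modules such that $\mathrm{Hom}_R(J,E)$ is acyclic for every injective $R$-module $J$. Let $M$ be an $R$-complex whose homology is bounded to the left, that is, $\mathrm{H}_i(M)=0$ for all $i\gg 0$. Let $G$ be a complex of Gorenstein injective $R$-modules with $G_i=0$ for all $i\gg 0$, and suppose that $M\simeq G$ in $\mathrm{D}(R)$. Then $M$ has a semiinjective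 resolution, and for every semiinjective resolution $M\to E$ one has $$\mathbf{R}\Gamma_{\mathfrak{a}}(M)=\Gamma_{\mathfrak{a}}(E)\simeq\Gamma_{\mathfrak{a}}(G)\quad\text{in } \mathrm{D}(R).$$ -/

import Mathlib

open CategoryTheory Limits

universe w u

noncomputable section

namespace DerivedSection

variable {R : Type u} [CommRing R]

/-! Complexes are indexed cohomologically: a complex `M` with homological components `M_n` is the
cochain complex with `M.X i = M_{-i}`. Hence `M_n = 0` for all large `n` ("left-bounded") means
that the cochain complex is bounded below. -/

/-- The section functor `Γ_𝔞`: it sends an `R`-module `N` to the submodule of the elements that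
are annihilated by some power of `𝔞`. -/
def Gamma (𝔞 : Ideal R) : ModuleCat.{u} R ⥤ ModuleCat.{u} R where
  obj N := ModuleCat.of R (𝔞.primaryComponent N)
  map f := ModuleCat.ofHom (Ideal.primaryComponent.map 𝔞 f.hom)

/-- The elements of `Γ_𝔞(N)`, explicitly. -/
theorem mem_primaryComponent_iff (𝔞 : Ideal R) (N : Type u) [AddCommGroup N] [Module R N] (x : N) :
    x ∈ 𝔞.primaryComponent N ↔ ∃ n : ℕ, ∀ r ∈ 𝔞 ^ n, r • x = 0 := by
  simp [Ideal.primaryComponent_mem, Submodule.mem_torsionBySet_iff]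

instance (𝔞 : Ideal R) : (Gamma 𝔞).Additive where
  map_add := rfl

/-- `Γ_𝔞` applied degreewise to a complex. -/
abbrev GammaComplex (𝔞 : Ideal R) :
    CochainComplex (ModuleCat.{u} R) ℤ ⥤ CochainComplex (ModuleCat.{u} R) ℤ :=
  (Gamma 𝔞).mapHomologicalComplex (ComplexShape.up ℤ)

/-- The morphism of complexes `Hom(Y, I) ⟶ Hom(X, I)` given by precomposition with `f : X ⟶ Y`. -/
def homComplexPrecomp {X Y : CochainComplex (ModuleCat.{u} R) ℤ} (f : X ⟶ Y)
    (I : CochainComplex (ModuleCat.{u} R) ℤ) :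
    CochainComplex.HomComplex Y I ⟶ CochainComplex.HomComplex X I where
  f n := AddCommGrpCat.ofHom
    { toFun := fun z : CochainComplex.HomComplex.Cochain Y I n =>
        (CochainComplex.HomComplex.Cochain.ofHom f).comp z (zero_add n)
      map_zero' := by simp
      map_add' := by simp }
  comm' n m _ := by
    ext z : 2
    exact CochainComplex.HomComplex.δ_ofHom_comp f z m

/-- A complex `I` is semiinjective if `Hom(-, I)` converts injective quasiisomorphisms into
surjective quasiisomorphisms. -/
def IsSemiinjective (I : CochainComplex (ModuleCat.{u} R) ℤ) : Prop :=
  ∀ ⦃X Y : CochainComplex (ModuleCat.{u} R) ℤ⦄ (f : X ⟶ Y), Mono f → QuasiIso f →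
    (∀ n : ℤ, Function.Surjective ((homComplexPrecomp f I).f n)) ∧
      QuasiIso (homComplexPrecomp f I)

/-- A semiinjective resolution of a complex `M`: a quasiisomorphism from `M` to a semiinjective
complex. -/
structure SemiinjectiveResolution (M : CochainComplex (ModuleCat.{u} R) ℤ) where
  /-- the semiinjective complex -/
  complex : CochainComplex (ModuleCat.{u} R) ℤ
  /-- the quasiisomorphism -/
  hom : M ⟶ complex
  quasiIso : QuasiIso hom
  isSemiinjective : IsSemiinjective complex

/-- The object `RΓ_𝔞(M) = Γ_𝔞(E)` of the derived category `D(R)`, formed with the semiinjective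
resolution `E` of `M`. -/
def RGamma (𝔞 : Ideal R) [HasDerivedCategory.{w} (ModuleCat.{u} R)]
    {M : CochainComplex (ModuleCat.{u} R) ℤ} (E : SemiinjectiveResolution M) :
    DerivedCategory (ModuleCat.{u} R) :=
  DerivedCategory.Q.obj ((GammaComplex 𝔞).obj E.complex)

/-- A module `N` is Gorenstein injective if there is an acyclic complex `E` of injective modules
such that `Hom(J, E)` is acyclic for every injective module `J` and such that `N` is isomorphic
to the kernel of `E_0 → E_{-1}`. -/
def IsGorensteinInjective (N : ModuleCat.{u} R) : Prop :=
  ∃ E : CochainComplex (ModuleCat.{u} R) ℤ,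
    (∀ i : ℤ, Injective (E.X i)) ∧
    E.Acyclic ∧
    (∀ J : ModuleCat.{u} R, Injective J →
      (((preadditiveCoyoneda.obj (Opposite.op J)).mapHomologicalComplex
        (ComplexShape.up ℤ)).obj E).Acyclic) ∧
    Nonempty (N ≅ kernel (E.d 0 1))

end DerivedSection

end

/-!
The point is that Gorenstein injective modules are acyclic for `Γ_𝔞`, so that `Γ_𝔞` of a bounded
below complex of such modules already computes `RΓ_𝔞`.

*Gorenstein injective modules are `Γ_𝔞`-acyclic.* Such a module is the module of cycles `Z^0(E)` in
an acyclic complex `E` of injective modules. Over a Noetherian ring `Γ_𝔞(E)` is again acyclic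
(`acyclic_gammaComplex_of_injective`). Since `Γ_{𝔞 + 𝔟} = Γ_𝔟 ∘ Γ_𝔞` and since `Γ_𝔞` preserves
injectives by the Artin–Rees lemma (`injective_primaryComponent`), this reduces to a principal ideal
`(x)`; there it holds because `I → I_x` is surjective for `I` injective
(`exists_pow_smul_eq_of_injective`). The higher right derived functors of `Γ_𝔞` at `N` are the groups
`colim_n Ext^i(R ⧸ 𝔞 ^ n, N)`, and acyclicity of a module is defined by their vanishing
(`IsGammaAcyclic`), so that the long exact `Ext` sequences are available. Dimension shifting
along `E` reduces the acyclicity of `Z^0(E)` to the acyclicity of `Γ_𝔞(E)`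
(`isGammaAcyclic_cycles_of_injective`).

*Comparison.* A bounded below complex `G` of `Γ_𝔞`-acyclic modules has an injective quasiisomorphism
`G ⟶ I` to a bounded below complex of injective modules. Its cokernel is an acyclic bounded below
complex of `Γ_𝔞`-acyclic modules, and such a complex stays acyclic under `Γ_𝔞`. Hence
`Γ_𝔞(G) ⟶ Γ_𝔞(I)` is a quasiisomorphism (`quasiIso_gammaComplex_map`).

*Resolutions.* The complex `I` is K-injective, hence semiinjective
(`isSemiinjective_of_isKInjective`), and the isomorphism `M ≃ I` in the derived category is
represented by a quasiisomorphism `M ⟶ I` (`exists_Q_map_eq`), which is a semiinjective resolution.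
Conversely, a semiinjective complex is K-injective (`IsSemiinjective.isKInjective`), so any
semiinjective resolution of `M` is homotopy equivalent to `I`, and `Γ_𝔞` preserves homotopy
equivalences (`nonempty_Q_gammaComplex_iso`).
-/

namespace DerivedSection

variable {R : Type u} [CommRing R]

/-! ### Sections of injective modules -/

/-- The localization map `I → I_x` of an injective module is surjective, stated without
denominators. -/
theorem exists_pow_smul_eq_of_injective [IsNoetherianRing R] {I : Type u} [AddCommGroup I]
    [Module R I] (hI : Module.Injective R I) (x : R) (u : I) (n : ℕ) :
    ∃ (k : ℕ) (v : I), x ^ k • u = x ^ (k + n) • v := by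
  -- The annihilators of the powers of `x` stabilize, say from the exponent `k` on.
  let a : ℕ →o Ideal R :=
    { toFun := fun k => LinearMap.ker (LinearMap.toSpanSingleton R R (x ^ k))
      monotone' := fun i j hij r hr => by
        obtain ⟨c, hc⟩ := pow_dvd_pow x hij
        simp only [LinearMap.mem_ker, LinearMap.toSpanSingleton_apply, smul_eq_mul] at hr ⊢
        rw [hc, ← mul_assoc, hr, zero_mul] }
  obtain ⟨k, hk⟩ := monotone_stabilizes_iff_noetherian.2 (inferInstanceAs (IsNoetherian R R)) a
  -- Hence `r * x ^ (k + n) ↦ r • x ^ k • u` is a well defined map on a principal ideal.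
  let f : (R ⧸ a (k + n)) →ₗ[R] R :=
    (a (k + n)).liftQ (LinearMap.toSpanSingleton R R (x ^ (k + n))) le_rfl
  have hf : Function.Injective f := by
    rw [← LinearMap.ker_eq_bot]
    exact Submodule.ker_liftQ_eq_bot _ _ _ le_rfl
  let g : (R ⧸ a (k + n)) →ₗ[R] I :=
    (a (k + n)).liftQ (LinearMap.toSpanSingleton R I (x ^ k • u)) (by
      rw [← hk (k + n) (Nat.le_add_right _ _)]
      intro r hr
      have hr' : r * x ^ k = 0 := hr
      simp [smul_smul, hr'])
  obtain ⟨h, hh⟩ := hI.out f hf g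
  refine ⟨k, h 1, ?_⟩
  have h1 := hh (Submodule.Quotient.mk 1)
  simp only [f, g, Submodule.liftQ_apply, LinearMap.toSpanSingleton_apply, one_smul] at h1
  rw [← map_smul, smul_eq_mul, mul_one, h1]

/-- A finitely generated submodule of `Γ_𝔞(N)` is annihilated by a single power of `𝔞`. -/
theorem exists_pow_smul_eq_zero (𝔞 : Ideal R) {J N : Type u} [AddCommGroup J] [Module R J]
    [Module.Finite R J] [AddCommGroup N] [Module R N] (f : J →ₗ[R] 𝔞.primaryComponent N) :
    ∃ n : ℕ, ∀ r ∈ 𝔞 ^ n, ∀ y : J, r • f y = 0 := by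
  obtain ⟨s, hs⟩ := Module.Finite.fg_top (R := R) (M := J)
  have hx (y : J) : ∃ n : ℕ, ∀ r ∈ 𝔞 ^ n, r • f y = 0 := by
    obtain ⟨n, hn⟩ := (mem_primaryComponent_iff 𝔞 N _).1 (f y).2
    exact ⟨n, fun r hr => Subtype.ext (hn r hr)⟩
  choose n hn using hx
  refine ⟨s.sup n, fun r hr y => ?_⟩
  have hy : y ∈ Submodule.span R (s : Set J) := hs ▸ Submodule.mem_top
  induction hy using Submodule.span_induction with
  | mem y hy => exact hn y r (Ideal.pow_le_pow_right (Finset.le_sup hy) hr)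
  | zero => simp
  | add y z _ _ hy hz => rw [map_add, smul_add, hy, hz, add_zero]
  | smul t y _ hy => rw [map_smul, smul_comm, hy, smul_zero]

/-- Over a Noetherian ring `Γ_𝔞` preserves injective modules. By the Artin–Rees lemma a map from an
ideal `J` to `Γ_𝔞(I)` factors over the image of `J` in some `R ⧸ 𝔞 ^ m`. -/
theorem injective_primaryComponent [IsNoetherianRing R] (𝔞 : Ideal R) {I : Type u}
    [AddCommGroup I] [Module R I] (hI : Module.Injective R I) :
    Module.Injective R (𝔞.primaryComponent I) := by
  refine Module.Baer.injective fun J f => ?_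
  obtain ⟨n, hn⟩ := exists_pow_smul_eq_zero 𝔞 f
  obtain ⟨k, hk⟩ := Ideal.exists_pow_inf_eq_pow_smul 𝔞 (M := R) J
  let p : Submodule R J := Submodule.comap J.subtype (𝔞 ^ (n + k))
  have hp : p ≤ LinearMap.ker f := by
    intro y hy
    have hAR : (y : R) ∈ 𝔞 ^ n * J := by
      have h := hk (n + k) (Nat.le_add_left _ _)
      simp only [smul_eq_mul, Ideal.mul_top, Nat.add_sub_cancel] at h
      exact Ideal.mul_mono_right inf_le_right (h.le ⟨hy, y.2⟩)
    have hy' : y ∈ 𝔞 ^ n • (⊤ : Submodule R J) := by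
      have h : 𝔞 ^ n * J = Submodule.map J.subtype (𝔞 ^ n • (⊤ : Submodule R J)) := by
        rw [Submodule.map_smul'', Submodule.map_top, Submodule.range_subtype, smul_eq_mul]
      rw [h] at hAR
      obtain ⟨z, hz, hzy⟩ := hAR
      rwa [← Subtype.ext (a1 := z) (a2 := y) hzy]
    refine Submodule.smul_induction_on hy' (fun r hr z _ => ?_) (fun z w hz hw => add_mem hz hw)
    rw [LinearMap.mem_ker, map_smul, hn r hr]
  let i : (J ⧸ p) →ₗ[R] (R ⧸ 𝔞 ^ (n + k)) := p.mapQ (𝔞 ^ (n + k)) J.subtype le_rfl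
  have hi : Function.Injective i := by
    rw [← LinearMap.ker_eq_bot]
    exact Submodule.ker_liftQ_eq_bot _ _ _ (by simp [p, LinearMap.ker_comp])
  obtain ⟨h, hh⟩ := hI.out i hi ((𝔞.primaryComponent I).subtype ∘ₗ p.liftQ f hp)
  refine ⟨LinearMap.codRestrict _ (h ∘ₗ Submodule.mkQ (𝔞 ^ (n + k))) fun r => ?_, fun y hy => ?_⟩
  · refine (mem_primaryComponent_iff 𝔞 I _).2 ⟨n + k, fun s hs => ?_⟩
    have h0 : Submodule.mkQ (𝔞 ^ (n + k)) (s • r) = 0 :=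
      (Submodule.Quotient.mk_eq_zero _).2 (Ideal.mul_mem_right _ _ hs)
    rw [← map_smul, LinearMap.comp_apply, h0, map_zero]
  · exact Subtype.ext (hh (Submodule.Quotient.mk ⟨y, hy⟩))

theorem injective_gamma_obj [IsNoetherianRing R] (𝔞 : Ideal R) (N : ModuleCat.{u} R)
    (hN : Injective N) : Injective ((Gamma 𝔞).obj N) := by
  have : Injective (ModuleCat.of R N) := hN
  have := injective_primaryComponent 𝔞 (Module.injective_module_of_injective_object R N)
  exact Module.injective_object_of_injective_module R (𝔞.primaryComponent N)

/-! ### Sections of acyclic complexes of injective modules -/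

/-- Acyclicity of a complex of modules in terms of elements. -/
theorem acyclic_iff_forall_exists (K : CochainComplex (ModuleCat.{u} R) ℤ) :
    K.Acyclic ↔ ∀ (i j k : ℤ), i + 1 = j → j + 1 = k → ∀ z : K.X j, K.d j k z = 0 →
      ∃ y : K.X i, K.d i j y = z := by
  constructor
  · rintro h i j k rfl rfl z hz
    have := (K.exactAt_iff' i (i + 1) (i + 1 + 1) (by simp) (by simp)).1 (h (i + 1))
    exact (ShortComplex.moduleCat_exact_iff _).1 this z hz
  · intro h j
    rw [K.exactAt_iff' (j - 1) j (j + 1) (by simp) (by simp), ShortComplex.moduleCat_exact_iff]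
    exact h (j - 1) j (j + 1) (by simp) rfl

/-- Acyclicity of `Γ_𝔞(K)` in terms of elements of `K`. -/
theorem acyclic_gammaComplex_iff (𝔞 : Ideal R) (K : CochainComplex (ModuleCat.{u} R) ℤ) :
    ((GammaComplex 𝔞).obj K).Acyclic ↔ ∀ (i j k : ℤ), i + 1 = j → j + 1 = k →
      ∀ z : K.X j, K.d j k z = 0 → z ∈ 𝔞.primaryComponent (K.X j) →
        ∃ y ∈ 𝔞.primaryComponent (K.X i), K.d i j y = z := by
  rw [acyclic_iff_forall_exists]
  refine forall₅_congr fun i j k _ _ => ⟨fun h z hz hz' => ?_, fun h z hz => ?_⟩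
  · obtain ⟨y, hy⟩ := h ⟨z, hz'⟩ (Subtype.ext hz)
    exact ⟨y.1, y.2, congrArg Subtype.val hy⟩
  · obtain ⟨y, hy, hyz⟩ := h z.1 (congrArg Subtype.val hz) z.2
    exact ⟨⟨y, hy⟩, Subtype.ext hyz⟩

/-- The case of a principal ideal. A preimage of a cycle annihilated by `x ^ n` is corrected by a
cycle, which is found by dividing by `x ^ n` up to `x`-torsion. -/
theorem acyclic_gammaComplex_span_singleton [IsNoetherianRing R] (x : R)
    (E : CochainComplex (ModuleCat.{u} R) ℤ) (hE : ∀ i, Injective (E.X i)) (hE' : E.Acyclic) :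
    ((GammaComplex (Ideal.span {x})).obj E).Acyclic := by
  rw [acyclic_iff_forall_exists] at hE'
  rw [acyclic_gammaComplex_iff]
  intro i j k hij hjk z hz hzx
  obtain ⟨n, hn⟩ := (mem_primaryComponent_iff _ _ _).1 hzx
  have hxz : x ^ n • z = 0 :=
    hn _ (Ideal.pow_mem_pow (Ideal.mem_span_singleton_self x) n)
  obtain ⟨y, rfl⟩ := hE' i j k hij hjk z hz
  obtain ⟨t, ht⟩ := hE' (i - 1) i j (by simp) hij (x ^ n • y) (by rw [map_smul, hxz])
  have : Injective (ModuleCat.of R (E.X (i - 1))) := hE (i - 1)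
  obtain ⟨m, v, hv⟩ := exists_pow_smul_eq_of_injective
    (Module.injective_module_of_injective_object R (E.X (i - 1))) x t n
  refine ⟨y - E.d (i - 1) i v, ?_, ?_⟩
  · refine (mem_primaryComponent_iff _ _ _).2 ⟨m + n, fun r hr => ?_⟩
    rw [Ideal.span_singleton_pow, Ideal.mem_span_singleton'] at hr
    obtain ⟨s, rfl⟩ := hr
    have h := congrArg (E.d (i - 1) i) hv
    rw [map_smul, map_smul, ht, smul_smul, ← pow_add] at h
    rw [mul_smul, smul_sub, h, sub_self, smul_zero]
  · rw [map_sub, sub_eq_self]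
    exact congrArg (fun f => f.hom v) (E.d_comp_d (i - 1) i j)

theorem mem_primaryComponent_sup_iff (𝔞 𝔟 : Ideal R) (N : Type u) [AddCommGroup N] [Module R N]
    (z : N) : z ∈ (𝔞 ⊔ 𝔟).primaryComponent N ↔
      z ∈ 𝔞.primaryComponent N ∧ z ∈ 𝔟.primaryComponent N := by
  simp only [mem_primaryComponent_iff]
  constructor
  · rintro ⟨n, hn⟩
    exact ⟨⟨n, fun r hr => hn r (Ideal.pow_right_mono le_sup_left n hr)⟩,
      ⟨n, fun r hr => hn r (Ideal.pow_right_mono le_sup_right n hr)⟩⟩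
  · rintro ⟨⟨n, hn⟩, ⟨m, hm⟩⟩
    refine ⟨n + m, fun r hr => ?_⟩
    obtain ⟨s, hs, t, ht, rfl⟩ := Submodule.mem_sup.1 (Ideal.sup_pow_add_le_pow_sup_pow hr)
    rw [add_smul, hn s hs, hm t ht, add_zero]

/-- `Γ_𝔞` preserves acyclicity of complexes of injective modules, by induction on the number of
generators of `𝔞`. The complex may be unbounded, as `Γ_𝔞` has finite cohomological dimension. -/
theorem acyclic_gammaComplex_of_injective [IsNoetherianRing R] (𝔞 : Ideal R)
    (E : CochainComplex (ModuleCat.{u} R) ℤ) (hE : ∀ i, Injective (E.X i)) (hE' : E.Acyclic) :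
    ((GammaComplex 𝔞).obj E).Acyclic := by
  refine Submodule.fg_induction (motive := fun 𝔞 (_ : 𝔞.FG) =>
    ∀ (E : CochainComplex (ModuleCat.{u} R) ℤ), (∀ i, Injective (E.X i)) → E.Acyclic →
      ((GammaComplex 𝔞).obj E).Acyclic) ?_ ?_ 𝔞 (IsNoetherian.noetherian 𝔞) E hE hE'
  · exact acyclic_gammaComplex_span_singleton
  · intro (𝔞 : Ideal R) (𝔟 : Ideal R) _ _ h𝔞 h𝔟 E hE hE'
    -- `Γ_{𝔞 + 𝔟} = Γ_𝔟 ∘ Γ_𝔞`, where `Γ_𝔞(E)` is again an acyclic complex of injectives.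
    have h := h𝔟 _ (fun i => injective_gamma_obj 𝔞 _ (hE i)) (h𝔞 E hE hE')
    rw [acyclic_gammaComplex_iff] at h ⊢
    intro i j k hij hjk z hz hz'
    obtain ⟨hza, hzb⟩ := (mem_primaryComponent_sup_iff 𝔞 𝔟 _ z).1 hz'
    have hb (l : ℤ) (w : 𝔞.primaryComponent (E.X l)) :
        w ∈ 𝔟.primaryComponent (𝔞.primaryComponent (E.X l)) ↔
          w.1 ∈ 𝔟.primaryComponent (E.X l) := by
      simp only [mem_primaryComponent_iff, Subtype.ext_iff]
      rfl
    obtain ⟨y, hy, hyz⟩ := h i j k hij hjk ⟨z, hza⟩ (Subtype.ext hz) ((hb j _).2 hzb)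
    exact ⟨y.1, (mem_primaryComponent_sup_iff 𝔞 𝔟 _ _).2 ⟨y.2, (hb i y).1 hy⟩,
      congrArg Subtype.val hyz⟩

end DerivedSection

noncomputable section

namespace DerivedSection

open CategoryTheory.Abelian

variable {R : Type u} [CommRing R]

/-! ### Modules that are acyclic for the section functor -/

/-- The projection `R ⧸ 𝔞 ^ m ⟶ R ⧸ 𝔞 ^ n` for `n ≤ m`. -/
def quotientPowMap (𝔞 : Ideal R) {n m : ℕ} (h : n ≤ m) :
    ModuleCat.of R (R ⧸ 𝔞 ^ m) ⟶ ModuleCat.of R (R ⧸ 𝔞 ^ n) :=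
  ModuleCat.ofHom (Submodule.factor (Ideal.pow_le_pow_right h))

theorem quotientPowMap_comp (𝔞 : Ideal R) {n m l : ℕ} (h : n ≤ m) (h' : m ≤ l) :
    quotientPowMap 𝔞 h' ≫ quotientPowMap 𝔞 h = quotientPowMap 𝔞 (h.trans h') := by
  ext
  rfl

/-- An element annihilated by `𝔞 ^ n`, as a morphism from `R ⧸ 𝔞 ^ n`. -/
theorem exists_hom_of_pow_smul_eq_zero (𝔞 : Ideal R) (N : ModuleCat.{u} R) (z : N) (n : ℕ)
    (hz : ∀ r ∈ 𝔞 ^ n, r • z = 0) :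
    ∃ φ : ModuleCat.of R (R ⧸ 𝔞 ^ n) ⟶ N, ∀ m, ∀ h : n ≤ m,
      (quotientPowMap 𝔞 h ≫ φ) (Submodule.Quotient.mk 1 : R ⧸ 𝔞 ^ m) = z :=
  ⟨ModuleCat.ofHom ((𝔞 ^ n).liftQ (LinearMap.toSpanSingleton R N z) hz), fun m h => by
    change (LinearMap.toSpanSingleton R N z) 1 = z
    simp⟩

theorem hom_apply_mem_primaryComponent (𝔞 : Ideal R) (N : ModuleCat.{u} R) (n : ℕ)
    (φ : ModuleCat.of R (R ⧸ 𝔞 ^ n) ⟶ N) (z : R ⧸ 𝔞 ^ n) :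
    φ.hom z ∈ 𝔞.primaryComponent N := by
  refine (mem_primaryComponent_iff 𝔞 N _).2 ⟨n, fun r hr => ?_⟩
  obtain ⟨z, rfl⟩ := Submodule.Quotient.mk_surjective _ z
  have : r • (Submodule.Quotient.mk z : R ⧸ 𝔞 ^ n) = 0 := by
    rw [← Submodule.Quotient.mk_smul, Submodule.Quotient.mk_eq_zero]
    exact Ideal.mul_mem_right _ _ hr
  exact (φ.hom.map_smul r _).symm.trans ((congrArg φ.hom this).trans φ.hom.map_zero)

theorem hom_ext_of_apply_one (𝔞 : Ideal R) {N : ModuleCat.{u} R} {n : ℕ}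
    {φ ψ : ModuleCat.of R (R ⧸ 𝔞 ^ n) ⟶ N}
    (h : φ.hom (Submodule.Quotient.mk 1 : R ⧸ 𝔞 ^ n) =
      ψ.hom (Submodule.Quotient.mk 1 : R ⧸ 𝔞 ^ n)) : φ = ψ := by
  refine ModuleCat.hom_ext (Submodule.linearMap_qext _ (LinearMap.ext_ring h))

/-- A module `N` is `Γ_𝔞`-acyclic if `colim_n Ext^i(R ⧸ 𝔞 ^ n, N) = 0` for all `i > 0`. The colimit
is spelled out: each class vanishes after pulling it back to some `R ⧸ 𝔞 ^ m`. -/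
def IsGammaAcyclic (𝔞 : Ideal R) (N : ModuleCat.{u} R) : Prop :=
  ∀ (k n : ℕ) (x : Ext (ModuleCat.of R (R ⧸ 𝔞 ^ n)) N (k + 1)),
    ∃ (m : ℕ) (h : n ≤ m), (Ext.mk₀ (quotientPowMap 𝔞 h)).comp x (zero_add (k + 1)) = 0

theorem isGammaAcyclic_of_injective (𝔞 : Ideal R) (N : ModuleCat.{u} R) (hN : Injective N) :
    IsGammaAcyclic 𝔞 N := fun _ n x =>
  ⟨n, le_rfl, by rw [x.eq_zero_of_injective, Ext.comp_zero]⟩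

theorem IsGammaAcyclic.of_iso {𝔞 : Ideal R} {N N' : ModuleCat.{u} R} (hN : IsGammaAcyclic 𝔞 N)
    (e : N ≅ N') : IsGammaAcyclic 𝔞 N' := by
  intro k n x
  obtain ⟨m, h, hm⟩ := hN k n (x.comp (Ext.mk₀ e.inv) (add_zero _))
  refine ⟨m, h, ?_⟩
  have := congrArg (fun y => Ext.comp y (Ext.mk₀ e.hom) (add_zero _)) hm
  simpa using this

/-- If `X₁` is `Γ_𝔞`-acyclic, a class with values in `X₃` lifts to `X₂` after restricting it to
some `R ⧸ 𝔞 ^ m`. -/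
theorem IsGammaAcyclic.exists_lift {𝔞 : Ideal R} {S : ShortComplex (ModuleCat.{u} R)}
    (hS : S.ShortExact) (h₁ : IsGammaAcyclic 𝔞 S.X₁) {k n : ℕ}
    (x : Ext (ModuleCat.of R (R ⧸ 𝔞 ^ n)) S.X₃ k) :
    ∃ (m : ℕ) (h : n ≤ m) (y : Ext (ModuleCat.of R (R ⧸ 𝔞 ^ m)) S.X₂ k),
      y.comp (Ext.mk₀ S.g) (add_zero k) =
        (Ext.mk₀ (quotientPowMap 𝔞 h)).comp x (zero_add k) := by
  obtain ⟨m, h, hm⟩ := h₁ k n (x.comp hS.extClass rfl)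
  exact ⟨m, h, Ext.covariant_sequence_exact₃ _ hS _ rfl (by
    rw [Ext.comp_assoc _ _ _ (zero_add k) rfl (by simp), hm])⟩

theorem IsGammaAcyclic.of_shortExact {𝔞 : Ideal R} {S : ShortComplex (ModuleCat.{u} R)}
    (hS : S.ShortExact) (h₁ : IsGammaAcyclic 𝔞 S.X₁) (h₂ : IsGammaAcyclic 𝔞 S.X₂) :
    IsGammaAcyclic 𝔞 S.X₃ := by
  intro k n x
  obtain ⟨m, h, y, hy⟩ := h₁.exists_lift hS x
  obtain ⟨l, h', hl⟩ := h₂ k m y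
  refine ⟨l, h.trans h', ?_⟩
  rw [← quotientPowMap_comp 𝔞 h h', ← Ext.mk₀_comp_mk₀_assoc, ← hy,
    ← Ext.comp_assoc _ _ _ (zero_add _) (add_zero _) (by simp), hl, Ext.zero_comp]

/-- `Γ_𝔞` is exact on short exact sequences whose left term is `Γ_𝔞`-acyclic. -/
theorem IsGammaAcyclic.exists_primaryComponent_lift {𝔞 : Ideal R}
    {S : ShortComplex (ModuleCat.{u} R)} (hS : S.ShortExact) (h₁ : IsGammaAcyclic 𝔞 S.X₁)
    (z : S.X₃) (hz : z ∈ 𝔞.primaryComponent S.X₃) :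
    ∃ y ∈ 𝔞.primaryComponent S.X₂, S.g y = z := by
  obtain ⟨n, hn⟩ := (mem_primaryComponent_iff _ _ _).1 hz
  obtain ⟨φ, hφ⟩ := exists_hom_of_pow_smul_eq_zero 𝔞 _ z n hn
  obtain ⟨m, h, y, hy⟩ := h₁.exists_lift hS (Ext.mk₀ φ)
  obtain ⟨ψ, rfl⟩ := (Ext.mk₀_bijective _ _).2 y
  rw [Ext.mk₀_comp_mk₀, Ext.mk₀_comp_mk₀] at hy
  have hψ := (Ext.mk₀_bijective _ _).1 hy
  refine ⟨ψ.hom (Submodule.Quotient.mk 1 : R ⧸ 𝔞 ^ m),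
    hom_apply_mem_primaryComponent 𝔞 _ m ψ _, ?_⟩
  rw [← hφ m h, ← hψ]
  rfl

/-! ### Cycles in acyclic complexes -/

/-- The short complex `Z^i ⟶ K^i ⟶ Z^{i+1}` attached to a complex `K`. -/
abbrev cyclesShortComplex (K : CochainComplex (ModuleCat.{u} R) ℤ) (i : ℤ) :
    ShortComplex (ModuleCat.{u} R) :=
  ShortComplex.mk (K.iCycles i) (K.toCycles i (i + 1)) (by
    rw [← cancel_mono (K.iCycles (i + 1))]
    simp)

theorem shortExact_cyclesShortComplex {K : CochainComplex (ModuleCat.{u} R) ℤ} (hK : K.Acyclic)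
    (i : ℤ) : (cyclesShortComplex K i).ShortExact where
  exact := by
    refine ShortComplex.exact_of_f_is_kernel _ ?_
    refine isKernelOfComp (K.iCycles (i + 1)) _ (K.cyclesIsKernel i (i + 1) (by simp)) _ ?_
    simp
  mono_f := inferInstanceAs (Mono (K.iCycles i))
  epi_g := by
    have h : (K.sc' i (i + 1) (i + 1 + 1)).Exact :=
      (K.exactAt_iff' i (i + 1) (i + 1 + 1) (by simp) (by simp)).1 (hK (i + 1))
    rw [ModuleCat.epi_iff_surjective]
    intro z
    obtain ⟨y, hy⟩ := (ShortComplex.moduleCat_exact_iff _).1 h (K.iCycles (i + 1) z)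
      (ConcreteCategory.congr_hom (K.iCycles_d (i + 1) (i + 1 + 1)) z)
    refine ⟨y, (ModuleCat.mono_iff_injective (K.iCycles (i + 1))).1 inferInstance ?_⟩
    exact (ConcreteCategory.congr_hom (K.toCycles_i i (i + 1)) y).trans hy

/-- The cycles of an acyclic complex `E` of injectives are `Γ_𝔞`-acyclic: by dimension shifting this
reduces to degree one, where it says that `Γ_𝔞(E)` is acyclic. -/
theorem isGammaAcyclic_cycles_of_injective [IsNoetherianRing R] (𝔞 : Ideal R)
    (E : CochainComplex (ModuleCat.{u} R) ℤ) (hE : ∀ i, Injective (E.X i)) (hE' : E.Acyclic)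
    (i : ℤ) : IsGammaAcyclic 𝔞 (E.cycles i) := by
  intro k
  induction k generalizing i with
  | zero =>
    intro n x
    have hS := shortExact_cyclesShortComplex hE' i
    have : Injective (cyclesShortComplex E i).X₂ := hE i
    obtain ⟨x₀, rfl⟩ := Ext.covariant_sequence_exact₁ _ hS x (Ext.eq_zero_of_injective _) rfl
    obtain ⟨φ, rfl⟩ := (Ext.mk₀_bijective _ _).2 x₀
    -- The class comes from a torsion cycle, which is a boundary of a torsion element.
    obtain ⟨y, hy, hyz⟩ := (acyclic_gammaComplex_iff 𝔞 E).1
      (acyclic_gammaComplex_of_injective 𝔞 E hE hE') i (i + 1) (i + 1 + 1) rfl rfl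
      ((φ ≫ E.iCycles (i + 1)).hom (Submodule.Quotient.mk 1 : R ⧸ 𝔞 ^ n))
      (ConcreteCategory.congr_hom (E.iCycles_d (i + 1) (i + 1 + 1)) _)
      (hom_apply_mem_primaryComponent 𝔞 _ n _ _)
    obtain ⟨m, hm⟩ := (mem_primaryComponent_iff _ _ _).1 hy
    have hm' : ∀ r ∈ 𝔞 ^ (n + m), r • y = 0 :=
      fun r hr => hm r (Ideal.pow_le_pow_right (Nat.le_add_left _ _) hr)
    obtain ⟨ψ, hψ⟩ := exists_hom_of_pow_smul_eq_zero 𝔞 _ y (n + m) hm'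
    have key : quotientPowMap 𝔞 (Nat.le_add_right n m) ≫ φ = ψ ≫ E.toCycles i (i + 1) := by
      rw [← cancel_mono (E.iCycles (i + 1))]
      refine hom_ext_of_apply_one 𝔞 ?_
      have h1 : ψ.hom (Submodule.Quotient.mk 1 : R ⧸ 𝔞 ^ (n + m)) = y := hψ (n + m) le_rfl
      rw [Category.assoc, Category.assoc, E.toCycles_i]
      refine Eq.trans ?_ (hyz.symm.trans (congrArg (E.d i (i + 1)) h1.symm))
      rfl
    refine ⟨n + m, Nat.le_add_right _ _, ?_⟩
    have h0 : (Ext.mk₀ (E.toCycles i (i + 1))).comp hS.extClass (zero_add 1) = 0 := hS.comp_extClass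
    rw [Ext.mk₀_comp_mk₀_assoc, key, ← Ext.mk₀_comp_mk₀_assoc, h0, Ext.comp_zero]
  | succ k ih =>
    intro n x
    have hS := shortExact_cyclesShortComplex hE' i
    have : Injective (cyclesShortComplex E i).X₂ := hE i
    obtain ⟨x₀, rfl⟩ := Ext.covariant_sequence_exact₁ _ hS x (Ext.eq_zero_of_injective _) rfl
    obtain ⟨m, h, hm⟩ := ih (i + 1) n x₀
    refine ⟨m, h, ?_⟩
    rw [← Ext.comp_assoc _ _ _ (zero_add _) rfl (by simp), hm, Ext.zero_comp]

theorem IsGorensteinInjective.isGammaAcyclic [IsNoetherianRing R] (𝔞 : Ideal R)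
    {N : ModuleCat.{u} R} (hN : IsGorensteinInjective N) : IsGammaAcyclic 𝔞 N := by
  obtain ⟨E, hE, hE', -, ⟨e⟩⟩ := hN
  refine (isGammaAcyclic_cycles_of_injective 𝔞 E hE hE' 0).of_iso (Iso.trans ?_ e.symm)
  exact (E.cyclesIsKernel 0 1 (by simp)).conePointUniqueUpToIso (limit.isLimit _)

/-- In a bounded below acyclic complex of `Γ_𝔞`-acyclic modules all cycles are `Γ_𝔞`-acyclic. -/
theorem isGammaAcyclic_cycles_of_isStrictlyGE (𝔞 : Ideal R)
    (K : CochainComplex (ModuleCat.{u} R) ℤ) (hK : K.Acyclic) (d : ℤ) [K.IsStrictlyGE d]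
    (h : ∀ i, IsGammaAcyclic 𝔞 (K.X i)) (i : ℤ) : IsGammaAcyclic 𝔞 (K.cycles i) := by
  have hlow (i : ℤ) (hi : i < d) : IsGammaAcyclic 𝔞 (K.cycles i) := by
    refine isGammaAcyclic_of_injective 𝔞 _ (IsZero.injective ?_)
    exact (K.isZero_of_isStrictlyGE d i hi).of_mono (K.iCycles i)
  have hup (n : ℕ) : IsGammaAcyclic 𝔞 (K.cycles (d - 1 + n)) := by
    induction n with
    | zero => exact hlow _ (by simp)
    | succ n ih =>
      have := IsGammaAcyclic.of_shortExact (shortExact_cyclesShortComplex hK (d - 1 + n)) ih (h _)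
      rwa [Nat.cast_succ, ← add_assoc]
  rcases lt_or_ge i d with hi | hi
  · exact hlow i hi
  · obtain ⟨n, hn⟩ := Int.eq_ofNat_of_zero_le (show 0 ≤ i - (d - 1) by lia)
    have : i = d - 1 + n := by lia
    exact this ▸ hup n

theorem acyclic_gammaComplex_of_isGammaAcyclic (𝔞 : Ideal R)
    (K : CochainComplex (ModuleCat.{u} R) ℤ) (hK : K.Acyclic) (d : ℤ) [K.IsStrictlyGE d]
    (h : ∀ i, IsGammaAcyclic 𝔞 (K.X i)) : ((GammaComplex 𝔞).obj K).Acyclic := by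
  rw [acyclic_gammaComplex_iff]
  rintro i j k rfl rfl z hz hz'
  have hcyc := isGammaAcyclic_cycles_of_isStrictlyGE 𝔞 K hK d h i
  obtain ⟨y₀, hy₀⟩ := (acyclic_iff_forall_exists K).1 hK i (i + 1) (i + 1 + 1) rfl rfl z hz
  have hinj := (ModuleCat.mono_iff_injective (K.iCycles (i + 1))).1 inferInstance
  have hw : K.iCycles (i + 1) (K.toCycles i (i + 1) y₀) = z :=
    (ConcreteCategory.congr_hom (K.toCycles_i i (i + 1)) y₀).trans hy₀
  obtain ⟨n, hn⟩ := (mem_primaryComponent_iff _ _ _).1 hz'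
  obtain ⟨y, hy, hyz⟩ := hcyc.exists_primaryComponent_lift (shortExact_cyclesShortComplex hK i)
    (K.toCycles i (i + 1) y₀) ((mem_primaryComponent_iff _ _ _).2 ⟨n, fun r hr => hinj (by
      rw [map_smul, hw, hn r hr, map_zero])⟩)
  refine ⟨y, hy, ?_⟩
  rw [← hw, ← hyz]
  exact (ConcreteCategory.congr_hom (K.toCycles_i i (i + 1)) y).symm

/-! ### Quasiisomorphisms preserved by sections -/

theorem shortExact_cokernel {C : Type*} [Category* C] [Abelian C] {X Y : C} (f : X ⟶ Y) [Mono f] :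
    (ShortComplex.mk f (cokernel.π f) (cokernel.condition f)).ShortExact where
  exact := ShortComplex.exact_cokernel f
  mono_f := inferInstanceAs (Mono f)
  epi_g := inferInstanceAs (Epi (cokernel.π f))

theorem quasiIso_f_of_acyclic {C : Type*} [Category* C] [Abelian C]
    {S : ShortComplex (CochainComplex C ℤ)} (hS : S.ShortExact) (h : S.X₃.Acyclic) :
    QuasiIso S.f where
  quasiIsoAt i := by
    rw [quasiIsoAt_iff_isIso_homologyMap]
    have : Mono (HomologicalComplex.homologyMap S.f i) :=
      (hS.homology_exact₁ (i - 1) i (by simp)).mono_g ((h (i - 1)).isZero_homology.eq_of_src _ _)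
    have : Epi (HomologicalComplex.homologyMap S.f i) :=
      (hS.homology_exact₂ i).epi_f ((h i).isZero_homology.eq_of_tgt _ _)
    exact isIso_of_mono_of_epi _

theorem quasiIso_g_of_acyclic {C : Type*} [Category* C] [Abelian C]
    {S : ShortComplex (CochainComplex C ℤ)} (hS : S.ShortExact) (h : S.X₁.Acyclic) :
    QuasiIso S.g where
  quasiIsoAt i := by
    rw [quasiIsoAt_iff_isIso_homologyMap]
    have : Mono (HomologicalComplex.homologyMap S.g i) :=
      (hS.homology_exact₂ i).mono_g ((h i).isZero_homology.eq_of_src _ _)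
    have : Epi (HomologicalComplex.homologyMap S.g i) :=
      (hS.homology_exact₃ i (i + 1) (by simp)).epi_f ((h (i + 1)).isZero_homology.eq_of_tgt _ _)
    exact isIso_of_mono_of_epi _

/-- `Γ_𝔞` preserves an injective quasiisomorphism between bounded below complexes of `Γ_𝔞`-acyclic
modules, since its cokernel is an acyclic complex of the same kind. -/
theorem quasiIso_gammaComplex_map (𝔞 : Ideal R) {K L : CochainComplex (ModuleCat.{u} R) ℤ}
    (f : K ⟶ L) [Mono f] [QuasiIso f] (d : ℤ) [L.IsStrictlyGE d]
    (hK : ∀ i, IsGammaAcyclic 𝔞 (K.X i)) (hL : ∀ i, IsGammaAcyclic 𝔞 (L.X i)) :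
    QuasiIso ((GammaComplex 𝔞).map f) := by
  let S : ShortComplex (CochainComplex (ModuleCat.{u} R) ℤ) :=
    ShortComplex.mk f (cokernel.π f) (cokernel.condition f)
  have hS : S.ShortExact := shortExact_cokernel f
  have hSi (i : ℤ) := (HomologicalComplex.shortExact_iff_degreewise_shortExact S).1 hS i
  have hQ : (cokernel f).Acyclic := hS.acyclic_X₃ (inferInstanceAs (QuasiIso f))
  have hQ' (i : ℤ) : IsGammaAcyclic 𝔞 ((cokernel f).X i) := (hK i).of_shortExact (hSi i) (hL i)
  have : (cokernel f).IsStrictlyGE d := by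
    rw [CochainComplex.isStrictlyGE_iff]
    intro i hi
    have := (hSi i).epi_g
    exact (L.isZero_of_isStrictlyGE d i hi).of_epi (S.g.f i)
  have hΓQ := acyclic_gammaComplex_of_isGammaAcyclic 𝔞 (cokernel f) hQ d hQ'
  have hΓS : (S.map (GammaComplex 𝔞)).ShortExact := by
    refine HomologicalComplex.shortExact_of_degreewise_shortExact _ fun i => ?_
    have hinj : Function.Injective (f.f i) := (hSi i).moduleCat_injective_f
    refine
      { exact := ?_
        mono_f := (ModuleCat.mono_iff_injective _).2 fun y z h =>
          Subtype.ext (hinj (congrArg Subtype.val h))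
        epi_g := (ModuleCat.epi_iff_surjective _).2 fun z => ?_ }
    · refine (ShortComplex.moduleCat_exact_iff _).2 fun z hz => ?_
      obtain ⟨y, hy⟩ := (ShortComplex.moduleCat_exact_iff _).1 (hSi i).exact z.1
        (congrArg Subtype.val hz)
      obtain ⟨n, hn⟩ := (mem_primaryComponent_iff _ _ _).1 z.2
      have hy' : y ∈ 𝔞.primaryComponent (K.X i) :=
        (mem_primaryComponent_iff _ _ _).2 ⟨n, fun r hr => hinj <|
          ((f.f i).hom.map_smul r y).trans <| (congrArg (r • ·) hy).trans <|
            (hn r hr).trans (f.f i).hom.map_zero.symm⟩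
      exact ⟨⟨y, hy'⟩, Subtype.ext hy⟩
    · obtain ⟨y, hy, hyz⟩ := (hK i).exists_primaryComponent_lift (hSi i) z.1 z.2
      exact ⟨⟨y, hy⟩, Subtype.ext hyz⟩
  exact quasiIso_f_of_acyclic hΓS hΓQ

end DerivedSection

end

noncomputable section

namespace DerivedSection

open CochainComplex CochainComplex.HomComplex
open scoped ZeroObject

variable {R : Type u} [CommRing R]

/-! ### Semiinjective and K-injective complexes -/

/-- Applied to `0 ⟶ K` with `K` acyclic, semiinjectivity says that `Hom(K, I)` is acyclic. -/
theorem IsSemiinjective.isKInjective {I : CochainComplex (ModuleCat.{u} R) ℤ}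
    (hI : IsSemiinjective I) : I.IsKInjective where
  nonempty_homotopy_zero {K} f hK := by
    have h0 : IsZero (0 : CochainComplex (ModuleCat.{u} R) ℤ) := isZero_zero _
    have hmono : Mono (0 : (0 : CochainComplex (ModuleCat.{u} R) ℤ) ⟶ K) :=
      ⟨fun _ _ _ => h0.eq_of_tgt _ _⟩
    have hX (i : ℤ) : IsZero ((0 : CochainComplex (ModuleCat.{u} R) ℤ).X i) :=
      (HomologicalComplex.eval _ _ i).map_isZero h0
    have hqis : QuasiIso (0 : (0 : CochainComplex (ModuleCat.{u} R) ℤ) ⟶ K) :=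
      ⟨fun i => (quasiIsoAt_iff_exactAt _ i
        (HomologicalComplex.ExactAt.of_isZero (hX i))).2 (hK i)⟩
    have hq := (hI _ hmono hqis).2
    have hex : (HomComplex K I).ExactAt 0 := by
      rw [exactAt_iff_of_quasiIsoAt
        (homComplexPrecomp (0 : (0 : CochainComplex (ModuleCat.{u} R) ℤ) ⟶ K) I) 0]
      refine HomologicalComplex.ExactAt.of_isZero ?_
      have : Subsingleton (Cochain (0 : CochainComplex (ModuleCat.{u} R) ℤ) I 0) :=
        ⟨fun a b => Cochain.ext a b fun p _ _ => (hX p).eq_of_src _ _⟩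
      exact AddCommGrpCat.isZero_of_subsingleton (AddCommGrpCat.of (Cochain _ I 0))
    rw [HomologicalComplex.exactAt_iff' _ (-1) 0 1 (by simp) (by simp)] at hex
    obtain ⟨α, hα⟩ := (ShortComplex.ab_exact_iff _).1 hex (Cochain.ofHom f) (δ_ofHom f)
    exact ⟨(Cochain.equivHomotopy f 0).symm ⟨α, by
      rw [Cochain.ofHom_zero, add_zero]
      exact hα.symm⟩⟩

/-- The kernel of the surjection `Hom(Y, I) ⟶ Hom(X, I)` induced by `f : X ⟶ Y` is
`Hom(coker f, I)`, which is acyclic. -/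
theorem isSemiinjective_of_isKInjective (I : CochainComplex (ModuleCat.{u} R) ℤ)
    [I.IsKInjective] (hI : ∀ i, Injective (I.X i)) : IsSemiinjective I := by
  intro X Y f hf hqis
  have hsurj (n : ℤ) : Function.Surjective ((homComplexPrecomp f I).f n) := by
    intro z
    change Cochain X I n at z
    refine ⟨(Cochain.mk fun p q hpq => Injective.factorThru (z.v p q hpq) (f.f p) :
      Cochain Y I n), ?_⟩
    change (Cochain.ofHom f).comp _ (zero_add n) = z
    ext p q hpq : 2
    simp
  let S : ShortComplex (CochainComplex (ModuleCat.{u} R) ℤ) :=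
    ShortComplex.mk f (cokernel.π f) (cokernel.condition f)
  have hS : S.ShortExact := shortExact_cokernel f
  have hSi (i : ℤ) := (HomologicalComplex.shortExact_iff_degreewise_shortExact S).1 hS i
  have hQ : (cokernel f).Acyclic := hS.acyclic_X₃ hqis
  let T : ShortComplex (CochainComplex AddCommGrpCat ℤ) :=
    ShortComplex.mk (homComplexPrecomp (cokernel.π f) I) (homComplexPrecomp f I) (by
      have h (n : ℤ) (z : Cochain (cokernel f) I n) : (Cochain.ofHom f).comp
          ((Cochain.ofHom (cokernel.π f)).comp z (zero_add n)) (zero_add n) = 0 := by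
        rw [← Cochain.comp_assoc_of_first_is_zero_cochain, ← Cochain.ofHom_comp,
          cokernel.condition, Cochain.ofHom_zero, Cochain.zero_comp]
      ext n z : 3
      exact h n z)
  have hT : T.ShortExact := by
    refine HomologicalComplex.shortExact_of_degreewise_shortExact _ fun n => ?_
    refine
      { exact := (ShortComplex.ab_exact_iff _).2 fun z hz => ?_
        mono_f := (AddCommGrpCat.mono_iff_injective _).2 fun a b hab => ?_
        epi_g := (AddCommGrpCat.epi_iff_surjective _).2 (hsurj n) }
    · change Cochain Y I n at z
      change (Cochain.ofHom f).comp z (zero_add n) = 0 at hz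
      have hz' (p q : ℤ) (hpq : p + n = q) : f.f p ≫ z.v p q hpq = 0 := by
        simpa using Cochain.congr_v hz p q hpq
      have hfac (p q : ℤ) (hpq : p + n = q) :
          ∃ c : (cokernel f).X p ⟶ I.X q, (cokernel.π f).f p ≫ c = z.v p q hpq :=
        ⟨(hSi p).gIsCokernel.desc (CokernelCofork.ofπ (z.v p q hpq) (hz' p q hpq)),
          (hSi p).gIsCokernel.fac (CokernelCofork.ofπ (z.v p q hpq) (hz' p q hpq))
            WalkingParallelPair.one⟩
      choose c hc using hfac
      refine ⟨(Cochain.mk c : Cochain (cokernel f) I n), ?_⟩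
      change (Cochain.ofHom (cokernel.π f)).comp (Cochain.mk c) (zero_add n) = z
      refine Cochain.ext _ _ fun p q hpq => ?_
      rw [Cochain.zero_cochain_comp_v, Cochain.ofHom_v, Cochain.mk_v, hc]
    · change Cochain (cokernel f) I n at a b
      change (Cochain.ofHom (cokernel.π f)).comp a (zero_add n) =
        (Cochain.ofHom (cokernel.π f)).comp b (zero_add n) at hab
      refine Cochain.ext a b fun p q hpq => ?_
      have := (hSi p).epi_g
      have h := Cochain.congr_v hab p q hpq
      rw [Cochain.zero_cochain_comp_v, Cochain.zero_cochain_comp_v, Cochain.ofHom_v] at h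
      exact (cancel_epi (S.g.f p)).1 h
  refine ⟨hsurj, quasiIso_g_of_acyclic hT fun n => ?_⟩
  rw [HomologicalComplex.exactAt_iff' _ (n - 1) n (n + 1) (by simp) (by simp),
    ShortComplex.ab_exact_iff]
  intro z hz
  exact IsKInjective.eq_δ_of_cocycle (K := cokernel f) (L := I)
    (Cocycle.mk (n := n) z (n + 1) rfl hz) hQ (n - 1) (by simp)

/-! ### Comparison in the derived category -/

variable [HasDerivedCategory.{w} (ModuleCat.{u} R)]

/-- A morphism in the derived category to a K-injective complex is represented by a morphism of
complexes. -/
theorem exists_Q_map_eq {M I : CochainComplex (ModuleCat.{u} R) ℤ} [I.IsKInjective]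
    (g : DerivedCategory.Q.obj M ⟶ DerivedCategory.Q.obj I) :
    ∃ f : M ⟶ I, DerivedCategory.Q.map f = g := by
  let e := DerivedCategory.quotientCompQhIso (ModuleCat.{u} R)
  obtain ⟨f, hf⟩ := (IsKInjective.Qh_map_bijective
    ((HomotopyCategory.quotient _ _).obj M) I).2 (e.hom.app M ≫ g ≫ e.inv.app I)
  obtain ⟨f, rfl⟩ := (HomotopyCategory.quotient _ _).map_surjective f
  refine ⟨f, ?_⟩
  have h := e.hom.naturality f
  rw [← cancel_epi (e.hom.app M), ← h]
  simp [hf]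

/-- `Γ_𝔞` sends K-injective complexes that are isomorphic in the derived category to isomorphic
objects of the derived category, because they are homotopy equivalent. -/
theorem nonempty_Q_gammaComplex_iso (𝔞 : Ideal R) {I J : CochainComplex (ModuleCat.{u} R) ℤ}
    [I.IsKInjective] [J.IsKInjective]
    (e : DerivedCategory.Q.obj I ≅ DerivedCategory.Q.obj J) :
    Nonempty (DerivedCategory.Q.obj ((GammaComplex 𝔞).obj I) ≅
      DerivedCategory.Q.obj ((GammaComplex 𝔞).obj J)) := by
  obtain ⟨f, hf⟩ := exists_Q_map_eq e.hom
  have hq : QuasiIso f := by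
    rw [← DerivedCategory.isIso_Q_map_iff_quasiIso, hf]
    infer_instance
  obtain ⟨h, rfl⟩ := (IsKInjective.quasiIso_iff f).1 hq
  have : QuasiIso ((GammaComplex 𝔞).map h.hom) :=
    ((Gamma 𝔞).mapHomotopyEquiv h).quasiIso_hom
  exact ⟨asIso (DerivedCategory.Q.map ((GammaComplex 𝔞).map h.hom))⟩

end DerivedSection

end

theorem mainTheorem6 {R : Type u} [CommRing R] [IsNoetherianRing R]
    [HasDerivedCategory.{w} (ModuleCat.{u} R)]
    (𝔞 : Ideal R) (h𝔞 : 𝔞 ≠ ⊤)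
    (M : CochainComplex (ModuleCat.{u} R) ℤ) (hM : ∃ n : ℤ, M.IsGE n)
    (G : CochainComplex (ModuleCat.{u} R) ℤ) (hGb : ∃ n : ℤ, G.IsStrictlyGE n)
    (hG : ∀ i : ℤ, DerivedSection.IsGorensteinInjective (G.X i))
    (hMG : Nonempty (DerivedCategory.Q.obj M ≅ DerivedCategory.Q.obj G)) :
    Nonempty (DerivedSection.SemiinjectiveResolution M) ∧
      ∀ E : DerivedSection.SemiinjectiveResolution M,
        Nonempty (DerivedSection.RGamma 𝔞 E ≅
          DerivedCategory.Q.obj ((DerivedSection.GammaComplex 𝔞).obj G)) := by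
  obtain ⟨d, hd⟩ := hGb
  obtain ⟨e⟩ := hMG
  obtain ⟨I, i, hi, hqi, hI, hId⟩ :=
    CochainComplex.Plus.modelCategoryQuillen.exists_mono_quasiIso_injective G (d - 1) d
  have hIK : I.IsKInjective := CochainComplex.isKInjective_of_injective I (d - 1)
  have hΓ : QuasiIso ((DerivedSection.GammaComplex 𝔞).map i) :=
    DerivedSection.quasiIso_gammaComplex_map 𝔞 i (d - 1)
      (fun j => (hG j).isGammaAcyclic 𝔞)
      (fun j => DerivedSection.isGammaAcyclic_of_injective 𝔞 _ (hI j))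
  let e' : DerivedCategory.Q.obj M ≅ DerivedCategory.Q.obj I :=
    e ≪≫ asIso (DerivedCategory.Q.map i)
  constructor
  -- `I` resolves both `G` and `M`: the isomorphism `M ≃ I` lifts to a morphism of complexes.
  · obtain ⟨f, hf⟩ := DerivedSection.exists_Q_map_eq e'.hom
    exact ⟨⟨I, f, by
      rw [← DerivedCategory.isIso_Q_map_iff_quasiIso, hf]
      infer_instance, DerivedSection.isSemiinjective_of_isKInjective I hI⟩⟩
  · intro E
    have := E.quasiIso
    have := E.isSemiinjective.isKInjective
    obtain ⟨ε⟩ := DerivedSection.nonempty_Q_gammaComplex_iso 𝔞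
      ((asIso (DerivedCategory.Q.map E.hom)).symm ≪≫ e')
    exact ⟨ε ≪≫ (asIso (DerivedCategory.Q.map ((DerivedSection.GammaComplex 𝔞).map i))).symm⟩
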